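/- Let $d\in\mathbb N$, let $X$ be a standard Gaussian vector in $\mathbb R^d$ and let $\varphi:\mathbb R^d\to\mathbb R$ be measurable, with (i) $\mathbb E[\varphi(X)^2e^{-\theta\cdot X}]<\infty$ for every $\theta\in\mathbb R^d$; (ii) $\mathbb P(\varphi(X)\neq 0)>0$; (iii) $\mathbb E[|\varphi(X)|^{4+\delta}]<\infty$ for some $\delta>0$. Put $v(\theta)=\mathbb E\big[\varphi(X)^2e^{-\theta\cdot X+|\theta|^2/2}\big]$. Let $X_1,X_2,\dots$ be i.i.d. copies of $X$, put $$v_n(\theta)=\frac1n\sum_{i=1}^n\varphi(X_i)^2e^{-\theta\cdot X_i+|\theta|^2/2},$$ and for each $n\ge 1$ let $\theta_n$ be (almost surely) a minimizer of $v_n$ over $\mathbb R^d$. Then $v$ has exactly one critical point $\theta^\star$ (that is, $v$ is differentiable at $\theta^\star$ with $\nabla v(\theta^\star)=0$, and $\theta^\star$ is the only such point), this $\theta^\star$ minimizes $v$ over $\mathbb R^d$, and $$\sqrt n\,\big(v_n(\theta_n)-v(\theta^\star)\big)\xrightarrow{\ \mathcal L\ }\mathcal N\big(0,(\gamma^\star)^2\big),\qquad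 (\gamma^\star)^2=\operatorname{Var}\Big(\varphi(X)^2e^{-\theta^\star\cdot X+|\theta^\star|^2/2}\Big)<\infty .$$ (If $\gamma^\star=0$, the limit is the Dirac mass at $0$.) -/

import Mathlib

open MeasureTheory ProbabilityTheory Filter Topology
open scoped RealInnerProductSpace

noncomputable section

/-- The function `x ↦ φ(x)² exp(-θ·x + |θ|²/2)` on `ℝᵈ`. -/
def isWeight {d : ℕ} (φ : EuclideanSpace ℝ (Fin d) → ℝ) (θ x : EuclideanSpace ℝ (Fin d)) : ℝ :=
  φ x ^ 2 * Real.exp (-⟪θ, x⟫ + ‖θ‖ ^ 2 / 2)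

/-- The second moment `v(θ) = E[φ(X)² exp(-θ·X + |θ|²/2)]`, with `X` standard Gaussian in `ℝᵈ`. -/
def secondMoment {d : ℕ} (φ : EuclideanSpace ℝ (Fin d) → ℝ) (θ : EuclideanSpace ℝ (Fin d)) : ℝ :=
  ∫ x, isWeight φ θ x ∂(stdGaussian (EuclideanSpace ℝ (Fin d)))

/-- The empirical second moment `vₙ(θ) = (1/n) ∑_{i<n} φ(xᵢ)² exp(-θ·xᵢ + |θ|²/2)`
of a sample `x₀, …, xₙ₋₁`. -/
def empiricalSecondMoment {d : ℕ} (φ : EuclideanSpace ℝ (Fin d) → ℝ)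
    (x : ℕ → EuclideanSpace ℝ (Fin d)) (n : ℕ) (θ : EuclideanSpace ℝ (Fin d)) : ℝ :=
  (1 / (n : ℝ)) * ∑ i ∈ Finset.range n, isWeight φ θ (x i)

end

/-! Each weight is an exponential in `θ`, and `e^u ≥ 1 + u` bounds it below by its tangent plane
plus its own value times `‖η - θ‖² / 2` (`isWeight_add_le`). This bound survives averaging. In
expectation it makes `v` coercive, and any critical point is the unique minimizer `θ⋆`. For `vₙ`,
minimizing the lower bound at `θ⋆` gives `2 vₙ(θ⋆) (vₙ(θ⋆) - vₙ(θₙ)) ≤ ‖∇vₙ(θ⋆)‖²`. The right side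
averages i.i.d. centred gradients, so its mean is `O(1/n)`. As `vₙ(θ⋆) → v(θ⋆) > 0`, replacing `θₙ`
by `θ⋆` costs `o(n^{-1/2})` in probability, and the CLT at the fixed point `θ⋆` with Slutsky's lemma
concludes. Neither consistency of `θₙ` nor a uniform law is needed. -/

/-! ### Gaussian moment bounds -/

/-- Gaussian measures have finite exponential moments of the norm. -/
theorem ProbabilityTheory.IsGaussian.integrable_exp_mul_norm {E : Type*} [NormedAddCommGroup E]
    [NormedSpace ℝ E] [MeasurableSpace E] [BorelSpace E] [SecondCountableTopology E]
    [CompleteSpace E] (μ : Measure E) [IsGaussian μ] (a : ℝ) :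
    Integrable (fun x => Real.exp (a * ‖x‖)) μ := by
  obtain ⟨C, hC, hint⟩ := IsGaussian.exists_integrable_exp_sq μ
  refine (hint.const_mul (Real.exp (a ^ 2 / (4 * C)))).mono' (by fun_prop) (ae_of_all _ fun x => ?_)
  rw [Real.norm_of_nonneg (Real.exp_nonneg _), ← Real.exp_add, Real.exp_le_exp]
  have h : a ^ 2 / (4 * C) + C * ‖x‖ ^ 2 - a * ‖x‖ = (2 * C * ‖x‖ - a) ^ 2 / (4 * C) := by
    field_simp
    ring
  have : 0 ≤ (2 * C * ‖x‖ - a) ^ 2 / (4 * C) := by positivity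
  linarith

/-- Whichever of `exp b` and `t ^ δ` is smaller is absorbed by the other. This trades the spare `δ`
moments of `φ` for exponential moments of the norm. -/
theorem pow_four_mul_exp_le {t δ b : ℝ} (ht : 0 ≤ t) (hδ : 0 < δ) :
    t ^ 4 * Real.exp b ≤ t ^ (4 + δ) + Real.exp ((4 / δ + 1) * b) := by
  have h4 : t ^ (4 : ℝ) = t ^ 4 := by exact_mod_cast Real.rpow_natCast t 4
  rcases le_total (Real.exp b) (t ^ δ) with h | h
  · have : t ^ 4 * Real.exp b ≤ t ^ (4 + δ) := by
      rw [Real.rpow_add_of_nonneg ht (by norm_num) hδ.le, h4]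
      gcongr
    linarith [Real.exp_pos ((4 / δ + 1) * b)]
  · have h1 : t ^ 4 ≤ Real.exp (4 / δ * b) := by
      calc t ^ 4 = (t ^ δ) ^ (4 / δ) := by
            rw [← Real.rpow_mul ht, mul_div_cancel₀ _ hδ.ne', h4]
        _ ≤ (Real.exp b) ^ (4 / δ) := by gcongr
        _ = Real.exp (4 / δ * b) := by rw [← Real.exp_mul, mul_comm]
    have : t ^ 4 * Real.exp b ≤ Real.exp ((4 / δ + 1) * b) := by
      rw [add_mul, one_mul, Real.exp_add]
      gcongr
    linarith [Real.rpow_nonneg ht (4 + δ)]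

theorem memLp_sq_mul_exp_mul_norm {E : Type*} [NormedAddCommGroup E]
    [NormedSpace ℝ E] [MeasurableSpace E] [BorelSpace E] [SecondCountableTopology E]
    [CompleteSpace E] {μ : Measure E} [IsGaussian μ] {φ : E → ℝ} (hφ : Measurable φ)
    {δ : ℝ} (hδ : 0 < δ) (hmom : Integrable (fun x => |φ x| ^ (4 + δ)) μ) (a : ℝ) :
    MemLp (fun x => φ x ^ 2 * Real.exp (a * ‖x‖)) 2 μ := by
  rw [memLp_two_iff_integrable_sq (by fun_prop)]
  refine (hmom.add (IsGaussian.integrable_exp_mul_norm μ ((4 / δ + 1) * (2 * a)))).mono'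
    (by fun_prop) (ae_of_all _ fun x => ?_)
  have h := pow_four_mul_exp_le (b := 2 * a * ‖x‖) (abs_nonneg (φ x)) hδ
  rw [Real.norm_of_nonneg (sq_nonneg _), Pi.add_apply]
  refine le_trans (le_of_eq ?_) (h.trans (le_of_eq (by ring_nf)))
  rw [show 2 * a * ‖x‖ = a * ‖x‖ + a * ‖x‖ by ring, Real.exp_add,
    show |φ x| ^ 4 = (|φ x| ^ 2) ^ 2 by ring, sq_abs]
  ring

/-! ### Pointwise bounds and convexity of the weight -/

section ImportanceSampling

variable {d : ℕ}

local notation "𝔼" d => EuclideanSpace ℝ (Fin d)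

/-- The gradient in `θ` of `isWeight φ θ x`. -/
noncomputable def weightGrad (φ : (𝔼 d) → ℝ) (θ x : 𝔼 d) : 𝔼 d :=
  isWeight φ θ x • (θ - x)

theorem isWeight_nonneg (φ : (𝔼 d) → ℝ) (θ x : 𝔼 d) : 0 ≤ isWeight φ θ x := by
  unfold isWeight; positivity

@[fun_prop]
theorem measurable_isWeight {φ : (𝔼 d) → ℝ} (hφ : Measurable φ) (θ : 𝔼 d) :
    Measurable (isWeight φ θ) := by
  unfold isWeight; fun_prop

@[fun_prop]
theorem measurable_weightGrad {φ : (𝔼 d) → ℝ} (hφ : Measurable φ) (θ : 𝔼 d) :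
    Measurable (weightGrad φ θ) := by
  unfold weightGrad; fun_prop

theorem isWeight_le {φ : (𝔼 d) → ℝ} {θ : 𝔼 d} {R : ℝ} (hR : ‖θ‖ ≤ R) (x : 𝔼 d) :
    isWeight φ θ x ≤ Real.exp (R ^ 2 / 2) * (φ x ^ 2 * Real.exp (R * ‖x‖)) := by
  have h1 : -⟪θ, x⟫ ≤ R * ‖x‖ := by
    have := abs_real_inner_le_norm θ x
    have := neg_abs_le ⟪θ, x⟫
    have : ‖θ‖ * ‖x‖ ≤ R * ‖x‖ := by gcongr
    linarith
  calc isWeight φ θ x ≤ φ x ^ 2 * Real.exp (R * ‖x‖ + R ^ 2 / 2) := by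
        unfold isWeight; gcongr
    _ = _ := by rw [Real.exp_add]; ring

theorem norm_weightGrad_le {φ : (𝔼 d) → ℝ} {θ : 𝔼 d} {R : ℝ} (hR : ‖θ‖ ≤ R) (x : 𝔼 d) :
    ‖weightGrad φ θ x‖ ≤
      Real.exp (R + R ^ 2 / 2) * (φ x ^ 2 * Real.exp ((R + 1) * ‖x‖)) := by
  -- Absorbing the linear factor into an exponential raises the rate from `R` to `R + 1`.
  have h1 : ‖θ - x‖ ≤ Real.exp (R + ‖x‖) := by
    have := norm_sub_le θ x
    have := Real.add_one_le_exp (R + ‖x‖)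
    linarith
  rw [weightGrad, norm_smul, Real.norm_of_nonneg (isWeight_nonneg _ _ _)]
  calc isWeight φ θ x * ‖θ - x‖
      ≤ Real.exp (R ^ 2 / 2) * (φ x ^ 2 * Real.exp (R * ‖x‖)) * Real.exp (R + ‖x‖) :=
        mul_le_mul (isWeight_le hR x) h1 (norm_nonneg _) (by positivity)
    _ = _ := by
      rw [add_mul, one_mul, Real.exp_add, Real.exp_add, Real.exp_add]
      ring

/-- The ratio of the weights at `η` and `θ` is exactly `exp u`; apply `1 + u ≤ exp u`. -/
theorem isWeight_add_le (φ : (𝔼 d) → ℝ) (θ η x : 𝔼 d) :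
    isWeight φ θ x + ⟪weightGrad φ θ x, η - θ⟫ + isWeight φ θ x * (‖η - θ‖ ^ 2 / 2)
      ≤ isWeight φ η x := by
  set u : ℝ := ⟪θ - x, η - θ⟫ + ‖η - θ‖ ^ 2 / 2 with hu
  have h1 : isWeight φ η x = isWeight φ θ x * Real.exp u := by
    unfold isWeight
    rw [mul_assoc, ← Real.exp_add]
    congr 2
    have h2 : ‖η‖ ^ 2 = ‖θ‖ ^ 2 + 2 * ⟪θ, η - θ⟫ + ‖η - θ‖ ^ 2 := by
      rw [← norm_add_sq_real, add_sub_cancel]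
    rw [hu, inner_sub_left, inner_sub_right x, real_inner_comm η x, real_inner_comm θ x]
    linarith
  rw [h1, weightGrad, real_inner_smul_left]
  have := mul_le_mul_of_nonneg_left (Real.add_one_le_exp u) (isWeight_nonneg φ θ x)
  clear_value u
  subst hu
  linarith

theorem hasFDerivAt_isWeight (φ : (𝔼 d) → ℝ) (θ x : 𝔼 d) :
    HasFDerivAt (fun θ => isWeight φ θ x) (innerSL ℝ (weightGrad φ θ x)) θ := by
  have h1 : HasFDerivAt (fun θ : 𝔼 d => -⟪θ, x⟫ + ‖θ‖ ^ 2 / 2) (innerSL ℝ (θ - x)) θ := by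
    have ha : HasFDerivAt (fun θ : 𝔼 d => ⟪x, θ⟫) (innerSL ℝ x) θ :=
      (innerSL ℝ x).hasFDerivAt
    have hb := (hasStrictFDerivAt_norm_sq θ).hasFDerivAt
    refine (((ha.neg).add (hb.const_mul (1 / 2))).congr_of_eventuallyEq ?_).congr_fderiv ?_
    · refine Eventually.of_forall fun y => ?_
      simp only [Pi.add_apply, Pi.neg_apply, real_inner_comm x]
      ring
    · ext y
      simp
      ring
  refine (h1.exp.const_mul (φ x ^ 2)).congr_fderiv ?_
  ext y
  simp [weightGrad, isWeight]
  ring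

/-! ### The second moment: gradient, coercivity, unique critical point -/

section Integrals

variable {φ : (𝔼 d) → ℝ} (hφ : Measurable φ) {δ : ℝ} (hδ : 0 < δ)
  (hmom : Integrable (fun x => |φ x| ^ (4 + δ)) (stdGaussian (𝔼 d)))

include hφ hδ hmom

theorem memLp_isWeight (θ : 𝔼 d) : MemLp (isWeight φ θ) 2 (stdGaussian (𝔼 d)) := by
  refine ((memLp_sq_mul_exp_mul_norm hφ hδ hmom ‖θ‖).const_mul (Real.exp (‖θ‖ ^ 2 / 2))).mono'
    (by fun_prop) (ae_of_all _ fun x => ?_)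
  rw [Real.norm_of_nonneg (isWeight_nonneg _ _ _)]
  exact isWeight_le le_rfl x

theorem memLp_weightGrad (θ : 𝔼 d) : MemLp (weightGrad φ θ) 2 (stdGaussian (𝔼 d)) :=
  ((memLp_sq_mul_exp_mul_norm hφ hδ hmom (‖θ‖ + 1)).const_mul
    (Real.exp (‖θ‖ + ‖θ‖ ^ 2 / 2))).mono' (by fun_prop)
    (ae_of_all _ fun x => norm_weightGrad_le le_rfl x)

theorem integrable_isWeight (θ : 𝔼 d) : Integrable (isWeight φ θ) (stdGaussian (𝔼 d)) :=
  (memLp_isWeight hφ hδ hmom θ).integrable one_le_two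

theorem integrable_weightGrad (θ : 𝔼 d) : Integrable (weightGrad φ θ) (stdGaussian (𝔼 d)) :=
  (memLp_weightGrad hφ hδ hmom θ).integrable one_le_two

theorem hasGradientAt_secondMoment (θ : 𝔼 d) :
    HasGradientAt (secondMoment φ) (∫ x, weightGrad φ θ x ∂(stdGaussian (𝔼 d))) θ := by
  rw [hasGradientAt_iff_hasFDerivAt]
  have hR : ∀ η ∈ Metric.ball θ 1, ‖η‖ ≤ ‖θ‖ + 1 := fun η hη => by
    have := norm_sub_norm_le η θ
    have := mem_ball_iff_norm.1 hη
    linarith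
  refine (hasFDerivAt_integral_of_dominated_of_fderiv_le
    (F' := fun η x => innerSL ℝ (weightGrad φ η x))
    (bound := fun x => Real.exp ((‖θ‖ + 1) + (‖θ‖ + 1) ^ 2 / 2) *
      (φ x ^ 2 * Real.exp (((‖θ‖ + 1) + 1) * ‖x‖)))
    (Metric.ball_mem_nhds θ one_pos) (Eventually.of_forall fun η => by fun_prop)
    (integrable_isWeight hφ hδ hmom θ)
    ((innerSL ℝ).continuous.comp_aestronglyMeasurable (by fun_prop))
    (ae_of_all _ fun x η hη => ?_)
    (((memLp_sq_mul_exp_mul_norm hφ hδ hmom _).integrable one_le_two).const_mul _)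
    (ae_of_all _ fun x η _ => hasFDerivAt_isWeight φ η x)).congr_fderiv ?_
  · rw [innerSL_apply_norm]
    exact norm_weightGrad_le (hR η hη) x
  · exact (innerSL ℝ).integral_comp_comm (integrable_weightGrad hφ hδ hmom θ)

theorem secondMoment_add_le (θ η : 𝔼 d) :
    secondMoment φ θ + ⟪∫ x, weightGrad φ θ x ∂(stdGaussian (𝔼 d)), η - θ⟫
      + secondMoment φ θ * (‖η - θ‖ ^ 2 / 2) ≤ secondMoment φ η := by
  have h1 := integrable_isWeight hφ hδ hmom θ
  have h2 := integrable_weightGrad hφ hδ hmom θ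
  have h3 : Integrable (fun x => ⟪weightGrad φ θ x, η - θ⟫) (stdGaussian (𝔼 d)) :=
    h2.inner_const _
  have h4 : ⟪∫ x, weightGrad φ θ x ∂(stdGaussian (𝔼 d)), η - θ⟫
      = ∫ x, ⟪weightGrad φ θ x, η - θ⟫ ∂(stdGaussian (𝔼 d)) := by
    rw [real_inner_comm, ← integral_inner h2]
    simp_rw [real_inner_comm]
  have h5 : Integrable (fun x => isWeight φ θ x + ⟪weightGrad φ θ x, η - θ⟫)
      (stdGaussian (𝔼 d)) := h1.add h3
  unfold secondMoment
  rw [h4, ← integral_mul_const, ← integral_add h1 h3, ← integral_add h5 (h1.mul_const _)]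
  exact integral_mono (h5.add (h1.mul_const _)) (integrable_isWeight hφ hδ hmom η)
    fun x => isWeight_add_le φ θ η x

theorem secondMoment_pos (hpos : 0 < stdGaussian (𝔼 d) {x | φ x ≠ 0}) (θ : 𝔼 d) :
    0 < secondMoment φ θ := by
  refine (integral_pos_iff_support_of_nonneg (fun x => isWeight_nonneg φ θ x)
    (integrable_isWeight hφ hδ hmom θ)).2 (hpos.trans_le (measure_mono fun x hx => ?_))
  simp only [Function.mem_support, isWeight]
  have : φ x ≠ 0 := hx
  positivity

theorem exists_isMinOn_secondMoment (hpos : 0 < stdGaussian (𝔼 d) {x | φ x ≠ 0}) :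
    ∃ θ, IsMinOn (secondMoment φ) Set.univ θ := by
  have hcont : Continuous (secondMoment φ) := continuous_iff_continuousAt.2 fun θ =>
    (hasGradientAt_secondMoment hφ hδ hmom θ).hasFDerivAt.continuousAt
  set c := secondMoment φ 0 with hc
  have hc0 : 0 < c := secondMoment_pos hφ hδ hmom hpos 0
  set g := ∫ x, weightGrad φ 0 x ∂(stdGaussian (𝔼 d))
  obtain ⟨θ, hθ⟩ := hcont.exists_forall_le' 0 (by
    -- Beyond this radius `c‖θ‖²/2` dominates `‖g‖‖θ‖`, so the value is at least that at `0`.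
    have hev : ∀ᶠ θ in cocompact (𝔼 d), 2 * ‖g‖ / c ≤ ‖θ‖ :=
      (tendsto_norm_cocompact_atTop (E := 𝔼 d)).eventually_ge_atTop _
    filter_upwards [hev] with θ hθ
    have h := secondMoment_add_le hφ hδ hmom 0 θ
    rw [sub_zero] at h
    have h1 := neg_le_of_abs_le (abs_real_inner_le_norm g θ)
    rw [div_le_iff₀ hc0] at hθ
    have h2 := mul_le_mul_of_nonneg_right hθ (norm_nonneg θ)
    linarith)
  exact ⟨θ, fun η _ => hθ η⟩

theorem hasGradientAt_secondMoment_zero_iff (hpos : 0 < stdGaussian (𝔼 d) {x | φ x ≠ 0})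
    {θ₀ : 𝔼 d} (hmin : IsMinOn (secondMoment φ) Set.univ θ₀) (θ : 𝔼 d) :
    HasGradientAt (secondMoment φ) 0 θ ↔ θ = θ₀ := by
  constructor
  · intro h
    have h0 := (hasGradientAt_secondMoment hφ hδ hmom θ).unique h
    have h1 := secondMoment_add_le hφ hδ hmom θ θ₀
    rw [h0, inner_zero_left] at h1
    have h2 : secondMoment φ θ₀ ≤ secondMoment φ θ := hmin (Set.mem_univ θ)
    have h3 := secondMoment_pos hφ hδ hmom hpos θ
    have h4 : ‖θ₀ - θ‖ ^ 2 ≤ 0 := by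
      by_contra! h5
      have := mul_pos h3 h5
      linarith
    have h5 : ‖θ₀ - θ‖ = 0 := by
      simpa using le_antisymm h4 (sq_nonneg _)
    exact (sub_eq_zero.1 (norm_eq_zero.1 h5)).symm
  · rintro rfl
    have h := hasGradientAt_secondMoment hφ hδ hmom θ
    have h1 := (hmin.isLocalMin univ_mem).hasFDerivAt_eq_zero h.hasFDerivAt
    rw [(InnerProductSpace.toDual ℝ _).map_eq_zero_iff] at h1
    rwa [h1] at h

end Integrals

/-! ### Convexity of the empirical second moment -/

section Empirical

variable (φ : (𝔼 d) → ℝ) (x : ℕ → 𝔼 d) (n : ℕ)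

theorem continuous_empiricalSecondMoment : Continuous (empiricalSecondMoment φ x n) := by
  unfold empiricalSecondMoment isWeight
  fun_prop

theorem empiricalSecondMoment_add_le (θ η : 𝔼 d) :
    empiricalSecondMoment φ x n θ
      + ⟪(1 / (n : ℝ)) • ∑ i ∈ Finset.range n, weightGrad φ θ (x i), η - θ⟫
      + empiricalSecondMoment φ x n θ * (‖η - θ‖ ^ 2 / 2) ≤ empiricalSecondMoment φ x n η := by
  unfold empiricalSecondMoment
  rw [real_inner_smul_left, sum_inner, mul_assoc, ← mul_add, ← mul_add, Finset.sum_mul,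
    ← Finset.sum_add_distrib, ← Finset.sum_add_distrib]
  gcongr
  exact isWeight_add_le φ θ η _

/-- The quadratic lower bound is optimized over `‖η - θ‖`. Keeping the factor `2V` on the left
avoids dividing by `V`, which may vanish. -/
theorem empiricalSecondMoment_mul_sub_le (θ η : 𝔼 d) :
    2 * empiricalSecondMoment φ x n θ *
      (empiricalSecondMoment φ x n θ - empiricalSecondMoment φ x n η)
      ≤ ‖(1 / (n : ℝ)) • ∑ i ∈ Finset.range n, weightGrad φ θ (x i)‖ ^ 2 := by
  have h := empiricalSecondMoment_add_le φ x n θ η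
  set g := (1 / (n : ℝ)) • ∑ i ∈ Finset.range n, weightGrad φ θ (x i)
  have hV : 0 ≤ empiricalSecondMoment φ x n θ :=
    mul_nonneg (by positivity) (Finset.sum_nonneg fun i _ => isWeight_nonneg _ _ _)
  set V := empiricalSecondMoment φ x n θ
  have h1 := neg_le_of_abs_le (abs_real_inner_le_norm g (η - θ))
  have h2 : V - empiricalSecondMoment φ x n η ≤ ‖g‖ * ‖η - θ‖ - V * (‖η - θ‖ ^ 2 / 2) := by
    linarith
  have h3 := mul_le_mul_of_nonneg_left h2 (by positivity : 0 ≤ 2 * V)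
  -- With `r = ‖η - θ‖`, `2V(‖g‖r - Vr²/2) = ‖g‖² - (‖g‖ - Vr)²`.
  nlinarith [sq_nonneg (‖g‖ - V * ‖η - θ‖)]

end Empirical

/-! ### Averages of independent vectors and negligible remainders -/

section Probability

variable {Ω : Type*} [MeasurableSpace Ω] {P : Measure Ω}

theorem MeasureTheory.MemLp.euclideanSpace_apply {f : Ω → 𝔼 d} {p : ENNReal} (hf : MemLp f p P)
    (j : Fin d) : MemLp (fun ω => f ω j) p P :=
  (EuclideanSpace.proj (𝕜 := ℝ) j).comp_memLp' hf

/-- Additivity of variance, applied to each coordinate and summed. -/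
theorem integral_norm_sq_sum_of_indepFun [IsProbabilityMeasure P] {ι : Type*} {Y : ι → Ω → 𝔼 d}
    {s : Finset ι} (hY : ∀ i ∈ s, MemLp (Y i) 2 P) (h0 : ∀ i ∈ s, ∫ ω, Y i ω ∂P = 0)
    (hindep : Set.Pairwise ↑s fun i j => Y i ⟂ᵢ[P] Y j) :
    ∫ ω, ‖∑ i ∈ s, Y i ω‖ ^ 2 ∂P = ∑ i ∈ s, ∫ ω, ‖Y i ω‖ ^ 2 ∂P := by
  have hYj : ∀ j, ∀ i ∈ s, MemLp (fun ω => Y i ω j) 2 P := fun j i hi =>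
    (hY i hi).euclideanSpace_apply j
  have h0j : ∀ j, ∀ i ∈ s, ∫ ω, Y i ω j ∂P = 0 := fun j i hi => by
    have := (EuclideanSpace.proj (𝕜 := ℝ) j).integral_comp_comm ((hY i hi).integrable one_le_two)
    simpa [h0 i hi] using this
  have hS : ∀ j, MemLp (∑ i ∈ s, fun ω => Y i ω j) 2 P := fun j => memLp_finsetSum' s (hYj j)
  have hcoord : ∀ j, ∫ ω, (∑ i ∈ s, Y i ω j) ^ 2 ∂P = ∑ i ∈ s, ∫ ω, Y i ω j ^ 2 ∂P := by
    intro j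
    have hvar := IndepFun.variance_sum (hYj j) (fun i hi k hk hik =>
      (hindep hi hk hik).comp (φ := fun y : 𝔼 d => y j) (ψ := fun y : 𝔼 d => y j)
        (by fun_prop) (by fun_prop))
    rw [variance_of_integral_eq_zero (hS j).aestronglyMeasurable.aemeasurable] at hvar
    · rw [Finset.sum_congr rfl fun i hi => variance_of_integral_eq_zero
        (hYj j i hi).aestronglyMeasurable.aemeasurable (h0j j i hi)] at hvar
      simpa using hvar
    · simp only [Finset.sum_apply]
      rw [integral_finsetSum _ fun i hi => (hYj j i hi).integrable one_le_two]
      exact Finset.sum_eq_zero (h0j j)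
  simp_rw [EuclideanSpace.real_norm_sq_eq]
  rw [integral_finsetSum _ fun j _ => by simpa using (hS j).integrable_sq]
  simp only [WithLp.ofLp_sum, Finset.sum_apply, hcoord]
  rw [Finset.sum_comm]
  exact Finset.sum_congr rfl fun i hi =>
    (integral_finsetSum _ fun j _ => (hYj j i hi).integrable_sq).symm

/-- The `L¹` norm equals `E‖Y₀‖² / √n` for `n ≥ 1`. -/
theorem tendstoInMeasure_sqrt_mul_norm_average_sq [IsProbabilityMeasure P] {Y : ℕ → Ω → 𝔼 d}
    (hY : MemLp (Y 0) 2 P) (h0 : ∫ ω, Y 0 ω ∂P = 0) (hindep : iIndepFun Y P)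
    (hident : ∀ i, IdentDistrib (Y i) (Y 0) P P) :
    TendstoInMeasure P (fun (n : ℕ) ω =>
      √(n : ℝ) * ‖(1 / (n : ℝ)) • ∑ i ∈ Finset.range n, Y i ω‖ ^ 2) atTop 0 := by
  have hYi : ∀ i, MemLp (Y i) 2 P := fun i => (hident i).symm.memLp_iff.1 hY
  have hS : ∀ n, MemLp (fun ω => ∑ i ∈ Finset.range n, Y i ω) 2 P := fun n =>
    memLp_finsetSum _ fun i _ => hYi i
  have hsq : ∀ n, ∫ ω, ‖∑ i ∈ Finset.range n, Y i ω‖ ^ 2 ∂P = n * ∫ ω, ‖Y 0 ω‖ ^ 2 ∂P := by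
    intro n
    have hI : ∀ i, ∫ ω, ‖Y i ω‖ ^ 2 ∂P = ∫ ω, ‖Y 0 ω‖ ^ 2 ∂P := fun i =>
      ((hident i).comp (u := fun y : 𝔼 d => ‖y‖ ^ 2) (by fun_prop)).integral_eq
    rw [integral_norm_sq_sum_of_indepFun (fun i _ => hYi i)
      (fun i _ => (hident i).integral_eq.trans h0) fun i _ j _ hij => hindep.indepFun hij,
      Finset.sum_congr rfl fun i _ => hI i]
    simp
  have hint : ∀ n : ℕ, Integrable (fun ω =>
      √(n : ℝ) * ‖(1 / (n : ℝ)) • ∑ i ∈ Finset.range n, Y i ω‖ ^ 2) P := fun n =>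
    (((hS n).const_smul (1 / (n : ℝ))).integrable_norm_pow two_ne_zero).const_mul _
  refine tendstoInMeasure_of_tendsto_eLpNorm one_ne_zero
    (fun n => (hint n).aestronglyMeasurable) aestronglyMeasurable_zero ?_
  have hval : ∀ n : ℕ, eLpNorm ((fun ω =>
      √(n : ℝ) * ‖(1 / (n : ℝ)) • ∑ i ∈ Finset.range n, Y i ω‖ ^ 2) - 0) 1 P
      = ENNReal.ofReal ((√(n : ℝ))⁻¹ * ∫ ω, ‖Y 0 ω‖ ^ 2 ∂P) := by
    intro n
    rw [sub_zero, eLpNorm_one_eq_lintegral_enorm, ← ofReal_integral_norm_eq_lintegral_enorm (hint n)]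
    congr 1
    simp_rw [Real.norm_of_nonneg (mul_nonneg (Real.sqrt_nonneg _) (sq_nonneg _)), norm_smul,
      mul_pow]
    rw [integral_const_mul, integral_const_mul, hsq]
    rcases Nat.eq_zero_or_pos n with rfl | hn
    · simp
    · have hn' : (0 : ℝ) < n := by exact_mod_cast hn
      have h1 : √(n : ℝ) * √(n : ℝ) = n := Real.mul_self_sqrt hn'.le
      have h2 : 0 < √(n : ℝ) := Real.sqrt_pos.2 hn'
      rw [norm_div, norm_one, Real.norm_of_nonneg hn'.le]
      field_simp
      linear_combination (∫ ω, ‖Y 0 ω‖ ^ 2 ∂P) * h1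
  simp_rw [hval]
  have h3 : Tendsto (fun n : ℕ => (√(n : ℝ))⁻¹ * ∫ ω, ‖Y 0 ω‖ ^ 2 ∂P) atTop (𝓝 0) := by
    have := (tendsto_inv_atTop_zero.comp (Real.tendsto_sqrt_atTop.comp
      tendsto_natCast_atTop_atTop)).mul_const (∫ ω, ‖Y 0 ω‖ ^ 2 ∂P)
    simpa [Function.comp_def] using this
  simpa using ENNReal.tendsto_ofReal h3

/-- Where `|V - v| < v/2`, one has `2V > v`, so `|R| ≥ ε` forces `A ≥ εv`. -/
theorem tendstoInMeasure_zero_of_mul_le {A V R : ℕ → Ω → ℝ} {v : ℝ} (hv : 0 < v)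
    (hA : TendstoInMeasure P A atTop 0) (hV : TendstoInMeasure P V atTop fun _ => v)
    (hle : ∀ᶠ n in atTop, ∀ᵐ ω ∂P, 2 * V n ω * |R n ω| ≤ A n ω) :
    TendstoInMeasure P R atTop 0 := by
  rw [tendstoInMeasure_iff_norm] at hA hV ⊢
  intro ε hε
  have hlim := (hA (ε * v) (by positivity)).add (hV (v / 2) (by positivity))
  rw [add_zero] at hlim
  refine tendsto_of_tendsto_of_tendsto_of_le_of_le' tendsto_const_nhds hlim
    (Eventually.of_forall fun _ => zero_le) (hle.mono fun n hn => ?_)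
  refine (measure_mono_ae (hn.mono fun ω hω (hR : ε ≤ ‖R n ω - 0‖) => ?_)).trans
    (measure_union_le _ _)
  by_contra hcon
  obtain ⟨h1, h2⟩ := not_or.1 hcon
  have h1 : ‖A n ω - 0‖ < ε * v := not_le.1 h1
  have h2 : ‖V n ω - v‖ < v / 2 := not_le.1 h2
  rw [sub_zero, Real.norm_eq_abs] at h1 hR
  have h3 := (abs_lt.1 h2).1
  have h4 : v * ε ≤ 2 * V n ω * |R n ω| :=
    mul_le_mul (by linarith) hR hε.le (by linarith)
  linarith [le_abs_self (A n ω)]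

end Probability

/-! ### Limit theorems for the sampled weights -/

section Sample

theorem ProbabilityTheory.HasLaw.memLp_comp {Ω E F : Type*} [MeasurableSpace Ω]
    [MeasurableSpace E] [NormedAddCommGroup F] {P : Measure Ω} {μ : Measure E} {X : Ω → E}
    (hX : HasLaw X μ P) {f : E → F} {p : ENNReal} (hf : MemLp f p μ) : MemLp (f ∘ X) p P := by
  rw [← hX.map_eq] at hf
  exact hf.comp_of_map hX.aemeasurable

variable {Ω : Type*} [MeasurableSpace Ω] {P : Measure Ω}
  {φ : (𝔼 d) → ℝ} {X : ℕ → Ω → 𝔼 d}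

theorem aemeasurable_empiricalSecondMoment (hφ : Measurable φ) (hX : ∀ i, AEMeasurable (X i) P)
    (n : ℕ) (θ : 𝔼 d) :
    AEMeasurable (fun ω => empiricalSecondMoment φ (fun i => X i ω) n θ) P := by
  unfold empiricalSecondMoment
  exact (Finset.aemeasurable_fun_sum _ fun i _ =>
    (measurable_isWeight hφ θ).comp_aemeasurable (hX i)).const_mul _

/-- The minimizer `T` itself need not be measurable: by continuity, the minimum value is an infimum
over a countable dense set. -/
theorem aemeasurable_empiricalSecondMoment_of_isMinOn (hφ : Measurable φ)
    (hX : ∀ i, AEMeasurable (X i) P) (n : ℕ) {T : Ω → 𝔼 d}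
    (hT : ∀ᵐ ω ∂P, IsMinOn (empiricalSecondMoment φ (fun i => X i ω) n) Set.univ (T ω)) :
    AEMeasurable (fun ω => empiricalSecondMoment φ (fun i => X i ω) n (T ω)) P := by
  have hinf : AEMeasurable (fun ω => ⨅ k : ℕ,
      empiricalSecondMoment φ (fun i => X i ω) n (TopologicalSpace.denseSeq (𝔼 d) k)) P :=
    AEMeasurable.iInf fun k => aemeasurable_empiricalSecondMoment hφ hX n _
  refine hinf.congr (hT.mono fun ω hω => ?_)
  have hle : ∀ θ, empiricalSecondMoment φ (fun i => X i ω) n (T ω) ≤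
      empiricalSecondMoment φ (fun i => X i ω) n θ := fun θ => hω (Set.mem_univ θ)
  refine le_antisymm ?_ (le_ciInf fun k => hle _)
  refine (TopologicalSpace.denseRange_denseSeq (𝔼 d)).induction_on
    (p := fun θ => (⨅ k : ℕ, empiricalSecondMoment φ (fun i => X i ω) n
      (TopologicalSpace.denseSeq (𝔼 d) k)) ≤ empiricalSecondMoment φ (fun i => X i ω) n θ)
    (T ω) (isClosed_le continuous_const (continuous_empiricalSecondMoment φ _ n)) fun k => ?_
  exact ciInf_le ⟨_, by rintro _ ⟨k, rfl⟩; exact hle _⟩ k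

variable [IsProbabilityMeasure P]

theorem tendstoInMeasure_empiricalSecondMoment (hφ : Measurable φ)
    (hlaw : ∀ i, HasLaw (X i) (stdGaussian (𝔼 d)) P) (hindep : iIndepFun X P) {θ : 𝔼 d}
    (hint : Integrable (isWeight φ θ) (stdGaussian (𝔼 d))) :
    TendstoInMeasure P (fun n ω => empiricalSecondMoment φ (fun i => X i ω) n θ) atTop
      fun _ => secondMoment φ θ := by
  refine tendstoInMeasure_of_tendsto_ae (fun n => (aemeasurable_empiricalSecondMoment hφ
    (fun i => (hlaw i).aemeasurable) n θ).aestronglyMeasurable) ?_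
  have hm := measurable_isWeight hφ θ
  have hslln := strong_law_ae_real (fun i => isWeight φ θ ∘ X i)
    (memLp_one_iff_integrable.1 ((hlaw 0).memLp_comp (memLp_one_iff_integrable.2 hint)))
    (fun i j hij => (hindep.indepFun hij).comp hm hm)
    (fun i => ((hlaw i).identDistrib (hlaw 0)).comp hm)
  filter_upwards [hslln] with ω hω
  rw [(hlaw 0).integral_comp hm.aestronglyMeasurable] at hω
  refine hω.congr fun n => ?_
  simp [empiricalSecondMoment, div_eq_inv_mul]

theorem tendstoInDistribution_empiricalSecondMoment (hφ : Measurable φ)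
    (hlaw : ∀ i, HasLaw (X i) (stdGaussian (𝔼 d)) P) (hindep : iIndepFun X P) {θ : 𝔼 d}
    (hL2 : MemLp (isWeight φ θ) 2 (stdGaussian (𝔼 d))) :
    TendstoInDistribution (fun (n : ℕ) ω => √(n : ℝ) *
        (empiricalSecondMoment φ (fun i => X i ω) n θ - secondMoment φ θ))
      atTop (id : ℝ → ℝ) (fun _ => P)
      (gaussianReal 0 (Var[isWeight φ θ; stdGaussian (𝔼 d)]).toNNReal) := by
  have hm := measurable_isWeight hφ θ
  have hvar : Var[isWeight φ θ ∘ X 0; P] = Var[isWeight φ θ; stdGaussian (𝔼 d)] := by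
    rw [← (hlaw 0).map_eq, variance_map hm.aemeasurable (hlaw 0).aemeasurable]
  have hclt := tendstoInDistribution_inv_sqrt_mul_sum_sub (P := P)
    (X := fun i => isWeight φ θ ∘ X i) (Y := id)
    (P' := gaussianReal 0 (Var[isWeight φ θ; stdGaussian (𝔼 d)]).toNNReal)
    (by rw [hvar]; exact HasLaw.id)
    ((hlaw 0).memLp_comp hL2)
    (hindep.comp _ fun _ => hm) (fun i => ((hlaw i).identDistrib (hlaw 0)).comp hm)
  refine hclt.congr (fun n => ae_of_all _ fun ω => ?_) Filter.EventuallyEq.rfl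
  rw [(hlaw 0).integral_comp hm.aestronglyMeasurable]
  change (√(n : ℝ))⁻¹ * (_ - n * secondMoment φ θ) = _
  simp only [Function.comp_apply, empiricalSecondMoment]
  rcases Nat.eq_zero_or_pos n with rfl | hn
  · simp
  · have hn' : (0 : ℝ) < n := by exact_mod_cast hn
    have h1 : √(n : ℝ) ^ 2 = n := Real.sq_sqrt hn'.le
    have h2 : 0 < √(n : ℝ) := Real.sqrt_pos.2 hn'
    field_simp
    rw [h1]

theorem tendstoInMeasure_sqrt_mul_empiricalSecondMoment_sub (hφ : Measurable φ)
    (hlaw : ∀ i, HasLaw (X i) (stdGaussian (𝔼 d)) P) (hindep : iIndepFun X P) {θ : 𝔼 d}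
    (hint : Integrable (isWeight φ θ) (stdGaussian (𝔼 d)))
    (hL2 : MemLp (weightGrad φ θ) 2 (stdGaussian (𝔼 d)))
    (hgrad : ∫ x, weightGrad φ θ x ∂(stdGaussian (𝔼 d)) = 0) (hv : 0 < secondMoment φ θ)
    {T : ℕ → Ω → 𝔼 d} (hT : ∀ n, 1 ≤ n → ∀ᵐ ω ∂P,
      IsMinOn (empiricalSecondMoment φ (fun i => X i ω) n) Set.univ (T n ω)) :
    TendstoInMeasure P (fun (n : ℕ) ω => √(n : ℝ) *
      (empiricalSecondMoment φ (fun i => X i ω) n (T n ω)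
        - empiricalSecondMoment φ (fun i => X i ω) n θ)) atTop 0 := by
  have hm := measurable_weightGrad hφ θ
  have hA := tendstoInMeasure_sqrt_mul_norm_average_sq (P := P)
    (Y := fun i => weightGrad φ θ ∘ X i)
    ((hlaw 0).memLp_comp hL2)
    (((hlaw 0).integral_comp hm.aestronglyMeasurable).trans hgrad)
    (hindep.comp _ fun _ => hm) (fun i => ((hlaw i).identDistrib (hlaw 0)).comp hm)
  refine tendstoInMeasure_zero_of_mul_le hv hA
    (tendstoInMeasure_empiricalSecondMoment hφ hlaw hindep hint) ?_
  filter_upwards [eventually_ge_atTop 1] with n hn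
  filter_upwards [hT n hn] with ω hω
  have h1 : empiricalSecondMoment φ (fun i => X i ω) n (T n ω) ≤
    empiricalSecondMoment φ (fun i => X i ω) n θ := hω (Set.mem_univ θ)
  have h2 := mul_le_mul_of_nonneg_left (empiricalSecondMoment_mul_sub_le φ (fun i => X i ω) n θ
    (T n ω)) (Real.sqrt_nonneg (n : ℝ))
  rw [abs_mul, abs_of_nonneg (Real.sqrt_nonneg _), abs_of_nonpos (sub_nonpos.2 h1)]
  refine le_trans (le_of_eq ?_) h2
  ring

end Sample

end ImportanceSampling

/-! ### Slutsky's lemma and conclusion -/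

theorem mainTheorem3 {d : ℕ} {Ω : Type*} [MeasurableSpace Ω]
    (P : Measure Ω) [IsProbabilityMeasure P]
    (φ : EuclideanSpace ℝ (Fin d) → ℝ) (hφ : Measurable φ)
    -- `E[φ(X)² exp(-θ·X)] < ∞` for every `θ`
    (hint : ∀ θ : EuclideanSpace ℝ (Fin d),
      Integrable (fun x => φ x ^ 2 * Real.exp (-⟪θ, x⟫))
        (stdGaussian (EuclideanSpace ℝ (Fin d))))
    -- `P(φ(X) ≠ 0) > 0`
    (hpos : 0 < stdGaussian (EuclideanSpace ℝ (Fin d)) {x | φ x ≠ 0})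
    -- `E[|φ(X)|^(4+δ)] < ∞` for some `δ > 0`
    (hmom : ∃ δ : ℝ, 0 < δ ∧ Integrable (fun x => |φ x| ^ (4 + δ))
      (stdGaussian (EuclideanSpace ℝ (Fin d))))
    -- i.i.d. standard Gaussian samples
    (X : ℕ → Ω → EuclideanSpace ℝ (Fin d))
    (hlaw : ∀ i, HasLaw (X i) (stdGaussian (EuclideanSpace ℝ (Fin d))) P)
    (hindep : iIndepFun X P)
    -- `θₙ` is a minimizer of the empirical second moment `vₙ`
    (θn : ℕ → Ω → EuclideanSpace ℝ (Fin d))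
    (hθn : ∀ n, 1 ≤ n → ∀ᵐ ω ∂P,
      IsMinOn (empiricalSecondMoment φ (fun i => X i ω) n) Set.univ (θn n ω)) :
    ∃ θstar : EuclideanSpace ℝ (Fin d),
      IsMinOn (secondMoment φ) Set.univ θstar ∧
      (∀ θ, HasGradientAt (secondMoment φ) 0 θ ↔ θ = θstar) ∧
      MemLp (isWeight φ θstar) 2 (stdGaussian (EuclideanSpace ℝ (Fin d))) ∧
      TendstoInDistribution
        (fun (n : ℕ) ω => √(n : ℝ) *
          (empiricalSecondMoment φ (fun i => X i ω) n (θn n ω) - secondMoment φ θstar))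
        atTop (id : ℝ → ℝ) (fun _ => P)
        (gaussianReal 0
          (Var[isWeight φ θstar; stdGaussian (EuclideanSpace ℝ (Fin d))]).toNNReal) := by
  obtain ⟨δ, hδ, hmom⟩ := hmom
  obtain ⟨θstar, hmin⟩ := exists_isMinOn_secondMoment hφ hδ hmom hpos
  have hL2 := memLp_isWeight hφ hδ hmom θstar
  have hcrit := hasGradientAt_secondMoment_zero_iff hφ hδ hmom hpos hmin
  have hgrad : ∫ x, weightGrad φ θstar x ∂(stdGaussian (EuclideanSpace ℝ (Fin d))) = 0 :=
    (hasGradientAt_secondMoment hφ hδ hmom θstar).unique ((hcrit θstar).2 rfl)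
  have hX : ∀ i, AEMeasurable (X i) P := fun i => (hlaw i).aemeasurable
  refine ⟨θstar, hmin, hcrit, hL2, ?_⟩
  refine tendstoInDistribution_of_tendstoInMeasure_sub _ _
    (tendstoInDistribution_empiricalSecondMoment hφ hlaw hindep hL2) ?_ fun n => ?_
  · convert! tendstoInMeasure_sqrt_mul_empiricalSecondMoment_sub hφ hlaw hindep
      (integrable_isWeight hφ hδ hmom θstar) (memLp_weightGrad hφ hδ hmom θstar) hgrad
      (secondMoment_pos hφ hδ hmom hpos θstar) hθn using 3 with n ω
    simp only [Pi.sub_apply]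
    ring
  -- Nothing is assumed of `θn 0`, but the factor `√0` kills that term.
  · rcases Nat.eq_zero_or_pos n with rfl | hn
    · simp
    · exact ((aemeasurable_empiricalSecondMoment_of_isMinOn hφ hX n (hθn n hn)).sub_const
        _).const_mul _
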